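/- For permutations $\tau\in\mathfrak S_k$ and $\sigma\in\mathfrak S_n$, let $\mathbf X^{\tau}(\sigma)$ be the number of $k$-element sets $\{s_1<\cdots<s_k\}\subseteq[n]$ such that $\tau(i)<\tau(j)\iff\sigma(s_i)<\sigma(s_j)$ for all $i,j\in[k]$. For $\sigma\in\mathfrak S_m$ and $\rho\in\mathfrak S_n$, regarded as permutations of $\{0,\dots,m-1\}$ and $\{0,\dots,n-1\}$, let $\sigma\otimes\rho\in\mathfrak S_{mn}$ be given by $(\sigma\otimes\rho)(j)=n\,\sigma(\lfloor j/n\rfloor)+\rho(j\bmod n)$ for $0\le j\le mn-1$. Let $\rho_n$ be a uniformly distributed random permutation in $\mathfrak S_n$. Call $\sigma\in\mathfrak S_m$ *$k$-inflatable* if $\sigma\otimes\rho_n$ is asymptotically $k$-symmetric in probability, that is, $mn\to\infty$ and, for every $\tau\in\mathfrak S_k$, $$\frac{k!^2\,\mathbf X^{\tau}(\sigma\otimes\rho_n)}{(mn)^k}\longrightarrow 1\quad\text{in probability as } n\to\infty .$$ For $\tau\in\mathfrak S_k$, let $\Pi^{\tau}_t$ be the set of partitions of $[k]$ into $t$ nonempty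 intervals $J_1<\cdots<J_t$ such that every $\tau(J_j)$ is also an interval. For $\pi=\{J_1<\cdots<J_t\}\in\Pi^\tau_t$, let $\tau/\pi\in\mathfrak S_t$ be the contracted permutation: $(\tau/\pi)(a)<(\tau/\pi)(b)$ iff $\tau(r_a)<\tau(r_b)$, where $r_j\in J_j$ for $1\le j\le t$ (the choice of the $r_j$ does not matter). **Lemma.** Let $k\ge 1$ and let $\sigma\in\mathfrak S_m$ be $k$-inflatable. Then for every $\tau\in\mathfrak S_k$, $$\frac{m^k}{k!^2}=\sum_{t=1}^k\ \sum_{\pi\in\Pi^\tau_t}\mathbf X^{\tau/\pi}(\sigma)\prod_{J\in\pi}\frac1{|J|!^{2}} .$$ -/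

import Mathlib

open Filter MeasureTheory
open scoped Topology Nat

namespace PermPattern

/-- `S` is an occurrence of the pattern `τ` in `σ`: `S` has `k` elements `s₀ < ⋯ < s_{k-1}`, and
`σ s₀, …, σ s_{k-1}` are in the same relative order as `τ 0, …, τ (k-1)`. -/
def IsOccurrence {k n : ℕ} (τ : Equiv.Perm (Fin k)) (σ : Equiv.Perm (Fin n))
    (S : Finset (Fin n)) : Prop :=
  ∃ h : S.card = k, ∀ i j : Fin k,
    τ i < τ j ↔ σ (S.orderEmbOfFin h i) < σ (S.orderEmbOfFin h j)

instance {k n : ℕ} (τ : Equiv.Perm (Fin k)) (σ : Equiv.Perm (Fin n)) (S : Finset (Fin n)) :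
    Decidable (IsOccurrence τ σ S) :=
  inferInstanceAs (Decidable (∃ h : S.card = k, ∀ i j : Fin k,
    τ i < τ j ↔ σ (S.orderEmbOfFin h i) < σ (S.orderEmbOfFin h j)))

/-- The number `X^τ(σ)` of occurrences of the pattern `τ` in `σ`. -/
def patternCount {k n : ℕ} (τ : Equiv.Perm (Fin k)) (σ : Equiv.Perm (Fin n)) : ℕ :=
  (Finset.univ.filter fun S : Finset (Fin n) => IsOccurrence τ σ S).card

/-- The tensor product `σ ⊗ ρ`, through the bijection `(x, y) ↦ b * x + y` from
`{0, …, a-1} × {0, …, b-1}` onto `{0, …, a*b-1}`. -/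
def tensor {a b : ℕ} (σ : Equiv.Perm (Fin a)) (ρ : Equiv.Perm (Fin b)) :
    Equiv.Perm (Fin (a * b)) :=
  finProdFinEquiv.symm.trans ((Equiv.prodCongr σ ρ).trans finProdFinEquiv)

/-- `(σ ⊗ ρ)(j) = b * σ(⌊j / b⌋) + ρ(j mod b)`. -/
theorem tensor_val {a b : ℕ} (σ : Equiv.Perm (Fin a)) (ρ : Equiv.Perm (Fin b))
    (j : Fin (a * b)) :
    (tensor σ ρ j : ℕ) = b * (σ j.divNat : ℕ) + (ρ j.modNat : ℕ) := by
  simp [tensor, finProdFinEquiv, add_comm]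

/-- A sequence of random permutations `σ n` of `N n` symbols, with `N n → ∞`, is asymptotically
`k`-symmetric in probability if for every pattern `τ` of length `k` the ratio
`k!² X^τ(σ n) / (N n)^k` converges to `1` in probability. The permutations may live on different
probability spaces `(Ω n, P n)`. -/
def AsymptoticallySymmetricInProbability (k : ℕ) {Ω : ℕ → Type*}
    [∀ n, MeasurableSpace (Ω n)] (P : ∀ n, Measure (Ω n)) (N : ℕ → ℕ)
    (σ : ∀ n, Ω n → Equiv.Perm (Fin (N n))) : Prop :=
  Tendsto N atTop atTop ∧
    ∀ τ : Equiv.Perm (Fin k), ∀ ε : ℝ, 0 < ε →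
      Tendsto (fun n => P n {ω | ε ≤
        |((k ! : ℝ) ^ 2 * (patternCount τ (σ n ω) : ℝ)) / (N n : ℝ) ^ k - 1|}) atTop (𝓝 0)

/-- The discrete `σ`-algebra on the finite set of permutations of `n` symbols. -/
instance (n : ℕ) : MeasurableSpace (Equiv.Perm (Fin n)) := ⊤

/-- The law of the uniform random permutation `ρ_n` of `n` symbols. -/
noncomputable def uniformPerm (n : ℕ) : Measure (Equiv.Perm (Fin n)) :=
  ProbabilityTheory.uniformOn Set.univ

/-- `σ` is `k`-inflatable: `σ ⊗ ρ_n`, with `ρ_n` uniformly random, is asymptotically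
`k`-symmetric in probability as `n → ∞`. -/
def Inflatable (k : ℕ) {m : ℕ} (σ : Equiv.Perm (Fin m)) : Prop :=
  AsymptoticallySymmetricInProbability k uniformPerm (fun n => m * n) fun _ ρ => tensor σ ρ

/-- `J` is an interval of `Fin k`. -/
def IsInterval {k : ℕ} (J : Finset (Fin k)) : Prop :=
  ∃ a b : Fin k, J = Finset.Icc a b

instance {k : ℕ} (J : Finset (Fin k)) : Decidable (IsInterval J) :=
  inferInstanceAs (Decidable (∃ a b : Fin k, J = Finset.Icc a b))

/-- `Π^τ_t`: the partitions of `Fin k` into `t` nonempty intervals, each of which `τ` maps onto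
an interval. -/
def consistentPartitions {k : ℕ} (τ : Equiv.Perm (Fin k)) (t : ℕ) :
    Finset (Finpartition (Finset.univ : Finset (Fin k))) :=
  Finset.univ.filter fun π =>
    π.parts.card = t ∧ ∀ J ∈ π.parts, IsInterval J ∧ IsInterval (J.map τ.toEmbedding)

/-- The least elements of the parts of `π`. -/
def representatives {k : ℕ} (π : Finpartition (Finset.univ : Finset (Fin k))) :
    Finset (Fin k) :=
  π.parts.attach.image fun J => J.1.min' (π.nonempty_of_mem_parts J.2)

theorem card_representatives {k : ℕ} (π : Finpartition (Finset.univ : Finset (Fin k))) :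
    (representatives π).card = π.parts.card := by
  rw [representatives, Finset.card_image_of_injective, Finset.card_attach]
  intro J K h
  have hJ := J.1.min'_mem (π.nonempty_of_mem_parts J.2)
  exact Subtype.ext (π.eq_of_mem_parts J.2 K.2 hJ ((congrArg (· ∈ K.1) h).mpr (K.1.min'_mem _)))

/-- The contracted permutation `τ / π` on as many symbols as `π` has parts: the relative order of
the values of `τ` at one representative `r₀ < r₁ < ⋯` of each part. If `π` is consistent with `τ`,
the choice of the representatives does not matter. -/
def contract {k : ℕ} (τ : Equiv.Perm (Fin k))
    (π : Finpartition (Finset.univ : Finset (Fin k))) : Equiv.Perm (Fin π.parts.card) :=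
  (((representatives π).orderIsoOfFin (card_representatives π)).toEquiv.trans
    (τ.subtypeEquiv fun _ => (Finset.mem_map' τ.toEmbedding).symm)).trans
    (((representatives π).map τ.toEmbedding).orderIsoOfFin
      ((Finset.card_map _).trans (card_representatives π))).symm.toEquiv

/-- The defining property of `τ / π`: `(τ / π)(a) < (τ / π)(b)` iff `τ(r_a) < τ(r_b)`. -/
theorem contract_lt_iff {k : ℕ} (τ : Equiv.Perm (Fin k))
    (π : Finpartition (Finset.univ : Finset (Fin k))) (a b : Fin π.parts.card) :
    contract τ π a < contract τ π b ↔
      τ ((representatives π).orderEmbOfFin (card_representatives π) a) <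
        τ ((representatives π).orderEmbOfFin (card_representatives π) b) := by
  unfold contract
  simp only [Equiv.trans_apply, OrderIso.coe_toEquiv, OrderIso.lt_iff_lt]
  rfl

end PermPattern

namespace PermPattern

/-! ### Counting increasing functions -/

/-! Compute the limit of the mean of `patternCount τ (tensor σ ρ)`, divided by `n ^ k`, in two ways;
the identity says that the two limits agree.

On one side, an occurrence of `τ` in `σ ⊗ ρ` splits into a block map `p : Fin k → Fin m` and a map
`y : Fin k → Fin n` of positions inside blocks. The order conditions separate
(`isEmbeddedPattern_tensor_iff`): `p` is a weak occurrence, `y` increases on the fibres of `p`, and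
`ρ ∘ y` increases on them in the order of `τ`. For injective `y` and uniform `ρ`, the tuple `ρ ∘ y`
is a uniform injective tuple, and non-injective `y` are negligible. So the two conditions on `y` and
`ρ ∘ y` become independent (`tendsto_mean`), and each has limiting density equal to the product of
`1/|F|!` over the fibres `F` of `p`. This gives the squared factorials.

On the other side, the normalised counts are bounded, so inflatability upgrades convergence in
probability to convergence of means, with limit `m ^ k / k! ^ 2` (`Inflatable.tendsto_mean`).

Finally, group the weak occurrences by their partition into fibres. These partitions are consistent
with `τ`, and those `p` with partition `π` are the occurrences of `τ / π` in `σ`, spread constantly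
over the parts (`card_isWeakPattern_fibrePartition_eq`). -/

/-- Functions increasing with respect to an injective labelling are counted by a binomial
coefficient. -/
theorem card_increasing {α β : Type*} [Finite α] [LinearOrder β] (e : α → β)
    (he : Function.Injective e) (n : ℕ) :
    Nat.card {y : α → Fin n // ∀ i j, e i < e j → y i < y j} = n.choose (Nat.card α) := by
  -- With the order pulled back along `e`, `α` is a finite chain, and the functions counted are its
  -- order embeddings into `Fin n`, that is, subsets of `Fin n` of size `|α|`.
  let : LinearOrder α := LinearOrder.lift' e he
  have := Fintype.ofFinite α
  let o : Fin (Fintype.card α) ≃o α := Fintype.orderIsoFinOfCardEq α rfl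
  have h1 : {y : α → Fin n // ∀ i j, e i < e j → y i < y j} ≃ (Fin (Fintype.card α) ↪o Fin n) :=
    { toFun := fun y => OrderEmbedding.ofStrictMono (y.1 ∘ o) fun i j hij =>
        y.2 _ _ (o.strictMono hij)
      invFun := fun g => ⟨g ∘ o.symm, fun i j hij => g.strictMono (o.symm.strictMono hij)⟩
      left_inv := fun y => by ext x; exact congrArg (fun t => (y.1 t : ℕ)) (o.apply_symm_apply x)
      right_inv := fun g => by ext x; exact congrArg (fun t => (g t : ℕ)) (o.symm_apply_apply x) }
  rw [Nat.card_congr h1, Nat.card_congr Set.powersetCard.ofFinEmbEquiv, Set.powersetCard.card]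
  simp

/-- `y` is increasing on each fibre of `p`, the fibre being ordered by the values of `τ`. -/
def FibrewiseIncreasing {k n : ℕ} {β : Type*} (τ : Equiv.Perm (Fin k)) (p : Fin k → β)
    (y : Fin k → Fin n) : Prop :=
  ∀ i j, p i = p j → τ i < τ j → y i < y j

/-- Different fibres impose independent conditions, and `τ` makes each fibre a chain. Empty fibres
contribute `n.choose 0 = 1`. -/
theorem card_fibrewiseIncreasing {k m : ℕ} (τ : Equiv.Perm (Fin k)) (p : Fin k → Fin m) (n : ℕ) :
    Nat.card {y : Fin k → Fin n // FibrewiseIncreasing τ p y} =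
      ∏ a, n.choose (Nat.card {i // p i = a}) := by
  have h : {y : Fin k → Fin n // FibrewiseIncreasing τ p y} ≃
      ((a : Fin m) → {y : {i // p i = a} → Fin n // ∀ i j, τ i.1 < τ j.1 → y i < y j}) :=
    { toFun := fun y a => ⟨fun i => y.1 i, fun i j => y.2 i j (i.2.trans j.2.symm)⟩
      invFun := fun z => ⟨fun i => (z (p i)).1 ⟨i, rfl⟩, fun i j hp hij => by
        have key : ∀ a, ∀ hi : p i = a, (z (p i)).1 ⟨i, rfl⟩ = (z a).1 ⟨i, hi⟩ := by
          rintro _ rfl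
          rfl
        exact (key _ hp).trans_lt ((z (p j)).2 ⟨i, hp⟩ ⟨j, rfl⟩ hij)⟩
      left_inv := fun y => rfl
      right_inv := fun z => by
        funext a
        ext ⟨i, rfl⟩
        rfl }
  rw [Nat.card_congr h, Nat.card_pi]
  exact Finset.prod_congr rfl fun a _ =>
    card_increasing _ (τ.injective.comp Subtype.val_injective) n

/-! ### Occurrences as increasing functions -/

/-- `f` lists an occurrence of `τ` in `σ` in increasing order. -/
def IsEmbeddedPattern {k n : ℕ} (τ : Equiv.Perm (Fin k)) (σ : Equiv.Perm (Fin n))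
    (f : Fin k → Fin n) : Prop :=
  StrictMono f ∧ ∀ i j, τ i < τ j → σ (f i) < σ (f j)

theorem lt_iff_lt_of_imp {k : ℕ} {β : Type*} [Preorder β] (τ : Equiv.Perm (Fin k)) {g : Fin k → β}
    (h : ∀ i j, τ i < τ j → g i < g j) (i j : Fin k) : τ i < τ j ↔ g i < g j := by
  refine ⟨h i j, fun hg => ?_⟩
  rcases lt_trichotomy (τ i) (τ j) with hlt | heq | hgt
  · exact hlt
  · rw [τ.injective heq] at hg
    exact absurd hg (lt_irrefl _)
  · exact absurd hg (lt_asymm (h j i hgt))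

theorem patternCount_eq_card {k n : ℕ} (τ : Equiv.Perm (Fin k)) (σ : Equiv.Perm (Fin n)) :
    patternCount τ σ = Nat.card {f : Fin k → Fin n // IsEmbeddedPattern τ σ f} := by
  rw [patternCount, ← Fintype.card_subtype, ← Nat.card_eq_fintype_card]
  refine Nat.card_congr (Equiv.ofBijective
    (fun S => ⟨S.1.orderEmbOfFin S.2.choose, (S.1.orderEmbOfFin S.2.choose).strictMono,
      fun i j => (S.2.choose_spec i j).1⟩) ⟨?_, ?_⟩)
  · rintro ⟨S, hS⟩ ⟨T, hT⟩ h
    have h' : (S.orderEmbOfFin hS.choose : Fin k → Fin n) = T.orderEmbOfFin hT.choose :=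
      congrArg Subtype.val h
    have := congrArg Set.range h'
    simpa using this
  · rintro ⟨f, hf, hσ⟩
    have hc : (Finset.univ.map ⟨f, hf.injective⟩).card = k := by simp
    have hu : f = (Finset.univ.map ⟨f, hf.injective⟩).orderEmbOfFin hc :=
      Finset.orderEmbOfFin_unique hc (by simp) hf
    refine ⟨⟨Finset.univ.map ⟨f, hf.injective⟩, hc, ?_⟩, Subtype.ext hu.symm⟩
    rw [← hu]
    exact lt_iff_lt_of_imp τ hσ

theorem patternCount_le {k n : ℕ} (τ : Equiv.Perm (Fin k)) (σ : Equiv.Perm (Fin n)) :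
    patternCount τ σ ≤ n ^ k := by
  rw [patternCount_eq_card]
  calc _ ≤ Nat.card (Fin k → Fin n) := Nat.card_le_card_of_injective _ Subtype.val_injective
    _ = n ^ k := by simp

/-! ### Occurrences in a tensor product -/

/-- `p` is weakly increasing, and `σ ∘ p` is weakly increasing with respect to `τ`. -/
def IsWeakPattern {k m : ℕ} (τ : Equiv.Perm (Fin k)) (σ : Equiv.Perm (Fin m))
    (p : Fin k → Fin m) : Prop :=
  Monotone p ∧ ∀ i j, τ i ≤ τ j → σ (p i) ≤ σ (p j)

instance {k m : ℕ} (τ : Equiv.Perm (Fin k)) (σ : Equiv.Perm (Fin m)) (p : Fin k → Fin m) :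
    Decidable (IsWeakPattern τ σ p) :=
  inferInstanceAs (Decidable ((∀ i j, i ≤ j → p i ≤ p j) ∧ ∀ i j, τ i ≤ τ j → σ (p i) ≤ σ (p j)))

theorem finProdFinEquiv_lt_iff {m n : ℕ} (a b : Fin m × Fin n) :
    finProdFinEquiv a < finProdFinEquiv b ↔ a.1 < b.1 ∨ a.1 = b.1 ∧ a.2 < b.2 := by
  obtain ⟨⟨a₁, _⟩, ⟨a₂, h₂⟩⟩ := a
  obtain ⟨⟨b₁, _⟩, ⟨b₂, h₃⟩⟩ := b
  simp only [finProdFinEquiv, Equiv.coe_fn_mk, Fin.lt_def, Fin.mk.injEq]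
  constructor
  · intro h
    rcases lt_trichotomy a₁ b₁ with hlt | rfl | hgt
    · exact Or.inl hlt
    · exact Or.inr ⟨rfl, by omega⟩
    · have := Nat.mul_le_mul_left n (Nat.succ_le_of_lt hgt)
      rw [Nat.mul_succ] at this
      omega
  · rintro (hlt | ⟨rfl, h⟩)
    · have := Nat.mul_le_mul_left n (Nat.succ_le_of_lt hlt)
      rw [Nat.mul_succ] at this
      omega
    · omega

/-- Order in the tensor product is lexicographic. This is applied twice: with `1` for positions and
with `τ` for values. -/
theorem lex_increasing_iff {k m n : ℕ} (τ : Equiv.Perm (Fin k)) (q : Fin k → Fin m)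
    (z : Fin k → Fin n) :
    (∀ i j, τ i < τ j → q i < q j ∨ q i = q j ∧ z i < z j) ↔
      (∀ i j, τ i ≤ τ j → q i ≤ q j) ∧ FibrewiseIncreasing τ q z := by
  constructor
  · refine fun h => ⟨fun i j hij => ?_, fun i j hq hij => ?_⟩
    · rcases hij.lt_or_eq with hlt | heq
      · rcases h i j hlt with h | h
        exacts [h.le, h.1.le]
      · rw [τ.injective heq]
    · rcases h i j hij with h | h
      exacts [absurd hq h.ne, h.2]
  · rintro ⟨hq, hz⟩ i j hij
    rcases (hq i j hij.le).lt_or_eq with hlt | heq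
    exacts [Or.inl hlt, Or.inr ⟨heq, hz i j heq hij⟩]

theorem isEmbeddedPattern_tensor_iff {k m n : ℕ} (τ : Equiv.Perm (Fin k))
    (σ : Equiv.Perm (Fin m)) (ρ : Equiv.Perm (Fin n)) (p : Fin k → Fin m) (y : Fin k → Fin n) :
    IsEmbeddedPattern τ (tensor σ ρ) (fun i => finProdFinEquiv (p i, y i)) ↔
      IsWeakPattern τ σ p ∧ FibrewiseIncreasing 1 p y ∧ FibrewiseIncreasing τ p (ρ ∘ y) := by
  have h1 := lex_increasing_iff 1 p y
  have h2 := lex_increasing_iff τ (σ ∘ p) (ρ ∘ y)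
  -- Since `σ` is injective, `σ ∘ p` and `p` have the same fibres.
  have h3 : FibrewiseIncreasing τ (σ ∘ p) (ρ ∘ y) ↔ FibrewiseIncreasing τ p (ρ ∘ y) := by
    simp [FibrewiseIncreasing]
  rw [h3] at h2
  simp only [IsEmbeddedPattern, IsWeakPattern, StrictMono, tensor, Equiv.trans_apply,
    Equiv.symm_apply_apply, Equiv.prodCongr_apply, Prod.map, finProdFinEquiv_lt_iff]
  simp only [Equiv.Perm.one_apply, Function.comp_apply] at h1 h2
  rw [h2, h1]
  unfold Monotone
  tauto

theorem patternCount_tensor {k m n : ℕ} (τ : Equiv.Perm (Fin k))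
    (σ : Equiv.Perm (Fin m)) (ρ : Equiv.Perm (Fin n)) :
    patternCount τ (tensor σ ρ) = ∑ p with IsWeakPattern τ σ p,
      Nat.card {y : Fin k → Fin n //
        FibrewiseIncreasing 1 p y ∧ FibrewiseIncreasing τ p (ρ ∘ y)} := by
  let e : (Fin k → Fin m) × (Fin k → Fin n) ≃ (Fin k → Fin (m * n)) :=
    (Equiv.arrowProdEquivProdArrow _ _ _).symm.trans (Equiv.arrowCongr (.refl _) finProdFinEquiv)
  have h : {q : (Fin k → Fin m) × (Fin k → Fin n) // IsWeakPattern τ σ q.1 ∧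
      FibrewiseIncreasing 1 q.1 q.2 ∧ FibrewiseIncreasing τ q.1 (ρ ∘ q.2)} ≃
      {f : Fin k → Fin (m * n) // IsEmbeddedPattern τ (tensor σ ρ) f} :=
    e.subtypeEquiv fun q => (isEmbeddedPattern_tensor_iff τ σ ρ q.1 q.2).symm
  rw [patternCount_eq_card, ← Nat.card_congr h,
    Nat.card_congr (Equiv.subtypeProdEquivSigmaSubtype fun p y => IsWeakPattern τ σ p ∧
      FibrewiseIncreasing 1 p y ∧ FibrewiseIncreasing τ p (ρ ∘ y)), Nat.card_sigma,
    Finset.sum_filter]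
  refine Finset.sum_congr rfl fun p _ => ?_
  split_ifs with hp <;> simp [hp]

/-! ### Averages over all permutations -/

/-- The symmetric group is transitive on injective `k`-tuples: if `g` carries `y` to `z`, left
multiplication by `g⁻¹` matches the two sets. -/
theorem card_perm_comp_eq {k n : ℕ} {y z : Fin k → Fin n} (hy : Function.Injective y)
    (hz : Function.Injective z) :
    Nat.card {ρ : Equiv.Perm (Fin n) // ρ ∘ y = z} =
      Nat.card {ρ : Equiv.Perm (Fin n) // ρ ∘ y = y} := by
  have := Equiv.Perm.isMultiplyPretransitive (Fin n) k
  obtain ⟨g, hg⟩ := MulAction.exists_smul_eq (Equiv.Perm (Fin n)) (⟨y, hy⟩ : Fin k ↪ Fin n) ⟨z, hz⟩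
  have hg' : g ∘ y = z := by
    funext i
    exact DFunLike.congr_fun hg i
  refine Nat.card_congr ((Equiv.mulLeft g⁻¹).subtypeEquiv fun ρ => ?_)
  rw [← hg']
  simp [funext_iff, Equiv.symm_apply_eq]

theorem card_injective (k n : ℕ) :
    Nat.card {y : Fin k → Fin n // Function.Injective y} = n.descFactorial k := by
  rw [Nat.card_congr (Equiv.subtypeInjectiveEquivEmbedding _ _), Nat.card_eq_fintype_card,
    Fintype.card_embedding_eq]
  simp

theorem card_perm_comp_mem_eq_mul {k n : ℕ} {y : Fin k → Fin n} (hy : Function.Injective y)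
    (H : (Fin k → Fin n) → Prop) :
    Nat.card {ρ : Equiv.Perm (Fin n) // H (ρ ∘ y)} =
      Nat.card {z : Fin k → Fin n // Function.Injective z ∧ H z} *
        Nat.card {ρ : Equiv.Perm (Fin n) // ρ ∘ y = y} := by
  classical
  have e : {ρ : Equiv.Perm (Fin n) // H (ρ ∘ y)} ≃
      Σ z : {z : Fin k → Fin n // Function.Injective z ∧ H z},
        {ρ : Equiv.Perm (Fin n) // ρ ∘ y = z.1} :=
    { toFun := fun ρ => ⟨⟨ρ.1 ∘ y, ρ.1.injective.comp hy, ρ.2⟩, ρ.1, rfl⟩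
      invFun := fun x => ⟨x.2.1, by
        rw [x.2.2]
        exact x.1.2.2⟩
      left_inv := fun ρ => rfl
      right_inv := fun x => by
        obtain ⟨⟨z, hz⟩, ⟨ρ, hρ⟩⟩ := x
        dsimp only at hρ
        subst hρ
        rfl }
  rw [Nat.card_congr e, Nat.card_sigma, Finset.sum_congr rfl fun z _ =>
    card_perm_comp_eq hy z.2.1, Finset.sum_const, Finset.card_univ, smul_eq_mul,
    ← Nat.card_eq_fintype_card]

/-- For injective `y` and uniformly random `ρ`, the tuple `ρ ∘ y` is a uniformly random injective
tuple. -/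
theorem descFactorial_mul_card_perm {k n : ℕ} {y : Fin k → Fin n} (hy : Function.Injective y)
    (H : (Fin k → Fin n) → Prop) :
    n.descFactorial k * Nat.card {ρ : Equiv.Perm (Fin n) // H (ρ ∘ y)} =
      n ! * Nat.card {z : Fin k → Fin n // Function.Injective z ∧ H z} := by
  -- The trivial condition determines the common fibre size: `n!` is `n.descFactorial k` times it.
  have h := card_perm_comp_mem_eq_mul hy fun _ => True
  simp only [and_true, card_injective] at h
  have h' : Nat.card {ρ : Equiv.Perm (Fin n) // True} = n ! := by
    simp [Fintype.card_perm]
  rw [card_perm_comp_mem_eq_mul hy H, ← h', h]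
  ring

theorem card_and_injective_bounds {k n : ℕ} (G : (Fin k → Fin n) → Prop) :
    Nat.card {y : Fin k → Fin n // Function.Injective y ∧ G y} ≤ Nat.card {y // G y} ∧
      Nat.card {y // G y} + n.descFactorial k ≤
        Nat.card {y : Fin k → Fin n // Function.Injective y ∧ G y} + n ^ k := by
  classical
  rw [← card_injective]
  simp only [Nat.card_eq_fintype_card, Fintype.card_subtype]
  rw [add_comm (Finset.card _), ← Finset.card_union_add_card_inter, ← Finset.filter_and, add_comm]
  refine ⟨Finset.card_le_card fun y => by simp, Nat.add_le_add_left ?_ _⟩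
  exact (Finset.card_le_univ _).trans (by simp)

/-- Exchange the sums over `ρ` and `y`. Injective `y` contribute exactly the product term; each of
the `n ^ k - n.descFactorial k` non-injective tuples contributes between `0` and `n!` before
normalisation. -/
theorem sum_card_perm_bounds {k n : ℕ} (hkn : k ≤ n) (G H : (Fin k → Fin n) → Prop) :
    (Nat.card {y : Fin k → Fin n // Function.Injective y ∧ G y} : ℝ) *
        Nat.card {y : Fin k → Fin n // Function.Injective y ∧ H y} / n.descFactorial k ≤
      (∑ ρ : Equiv.Perm (Fin n), (Nat.card {y : Fin k → Fin n // G y ∧ H (ρ ∘ y)} : ℝ)) / n ! ∧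
    (∑ ρ : Equiv.Perm (Fin n), (Nat.card {y : Fin k → Fin n // G y ∧ H (ρ ∘ y)} : ℝ)) / n ! ≤
      (Nat.card {y : Fin k → Fin n // Function.Injective y ∧ G y} : ℝ) *
        Nat.card {y : Fin k → Fin n // Function.Injective y ∧ H y} / n.descFactorial k +
      ((n : ℝ) ^ k - n.descFactorial k) := by
  classical
  have hD : (0 : ℝ) < n.descFactorial k := by
    exact_mod_cast Nat.descFactorial_pos.2 hkn
  have hn : (0 : ℝ) < n ! := by exact_mod_cast n.factorial_pos
  set P : (Fin k → Fin n) → ℝ := fun y => Nat.card {ρ : Equiv.Perm (Fin n) // H (ρ ∘ y)}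
  have hP0 : ∀ y, 0 ≤ P y := fun y => Nat.cast_nonneg _
  have hP1 : ∀ y, P y ≤ n ! := fun y => by
    have : Nat.card {ρ : Equiv.Perm (Fin n) // H (ρ ∘ y)} ≤ Nat.card (Equiv.Perm (Fin n)) :=
      Nat.card_le_card_of_injective _ Subtype.val_injective
    rw [Nat.card_perm, Nat.card_fin] at this
    exact Nat.cast_le.2 this
  have hswap : ∑ ρ : Equiv.Perm (Fin n), (Nat.card {y : Fin k → Fin n // G y ∧ H (ρ ∘ y)} : ℝ) =
      ∑ y with G y, P y := by
    simp only [P, Nat.card_eq_fintype_card, Fintype.card_subtype, ← Nat.cast_sum]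
    congr 1
    have := Finset.sum_card_bipartiteAbove_eq_sum_card_bipartiteBelow
      (s := (Finset.univ : Finset (Equiv.Perm (Fin n)))) (t := Finset.univ.filter G)
      (fun (ρ : Equiv.Perm (Fin n)) (y : Fin k → Fin n) => H (ρ ∘ y))
    simpa only [Finset.bipartiteAbove, Finset.bipartiteBelow, Finset.filter_filter] using this
  have hsplit := Finset.sum_filter_add_sum_filter_not (Finset.univ.filter G)
    (fun y => Function.Injective y) P
  have hmain : (∑ y ∈ Finset.univ.filter G with Function.Injective y, P y) / n ! =
      (Nat.card {y : Fin k → Fin n // Function.Injective y ∧ G y} : ℝ) *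
        Nat.card {y : Fin k → Fin n // Function.Injective y ∧ H y} / n.descFactorial k := by
    have : ∀ y ∈ (Finset.univ.filter G).filter (fun y => Function.Injective y), P y =
        n ! * Nat.card {y : Fin k → Fin n // Function.Injective y ∧ H y} / n.descFactorial k := by
      intro y hy
      rw [eq_div_iff hD.ne', mul_comm]
      have := descFactorial_mul_card_perm (Finset.mem_filter.1 hy).2 H
      simp only [P]
      exact_mod_cast this
    rw [Finset.sum_congr rfl this, Finset.sum_const, nsmul_eq_mul, Finset.filter_filter,
      Nat.card_eq_fintype_card (α := {y : Fin k → Fin n // Function.Injective y ∧ G y}),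
      Fintype.card_subtype]
    simp only [and_comm (a := G _)]
    field_simp
  have herr0 : 0 ≤ (∑ y ∈ Finset.univ.filter G with ¬ Function.Injective y, P y) / n ! :=
    div_nonneg (Finset.sum_nonneg fun y _ => hP0 y) hn.le
  have herr1 : (∑ y ∈ Finset.univ.filter G with ¬ Function.Injective y, P y) / n ! ≤
      (n : ℝ) ^ k - n.descFactorial k := by
    rw [div_le_iff₀ hn]
    refine (Finset.sum_le_card_nsmul _ _ _ fun y _ => hP1 y).trans ?_
    rw [nsmul_eq_mul]
    refine mul_le_mul_of_nonneg_right ?_ hn.le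
    have h1 : ((Finset.univ.filter G).filter fun y => ¬ Function.Injective y).card ≤
        (Finset.univ.filter fun y : Fin k → Fin n => ¬ Function.Injective y).card :=
      Finset.card_le_card (Finset.filter_subset_filter _ (Finset.subset_univ _))
    have h2 := Finset.card_filter_add_card_filter_not (s := Finset.univ)
      (fun y : Fin k → Fin n => Function.Injective y)
    have h3 := card_injective k n
    rw [Nat.card_eq_fintype_card, Fintype.card_subtype] at h3
    rw [h3, Finset.card_univ, Fintype.card_fun, Fintype.card_fin, Fintype.card_fin] at h2
    have h4 : (((Finset.univ.filter G).filter fun y => ¬ Function.Injective y).card : ℝ) +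
        n.descFactorial k ≤ (n : ℝ) ^ k := by
      exact_mod_cast by omega
    linarith
  rw [hswap, ← hsplit, add_div, hmain]
  constructor <;> linarith

theorem tendsto_descFactorial_div_pow (k : ℕ) :
    Tendsto (fun n : ℕ => (n.descFactorial k : ℝ) / (n : ℝ) ^ k) atTop (𝓝 1) := by
  refine (Asymptotics.isEquivalent_iff_tendsto_one ?_).1 (isEquivalent_descFactorial k)
  filter_upwards [eventually_gt_atTop 0] with n hn
  positivity

theorem tendsto_choose_div_pow (k : ℕ) :
    Tendsto (fun n : ℕ => (n.choose k : ℝ) / (n : ℝ) ^ k) atTop (𝓝 (k ! : ℝ)⁻¹) := by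
  have h := (tendsto_descFactorial_div_pow k).div_const (k ! : ℝ)
  rw [one_div] at h
  refine h.congr fun n => ?_
  rw [Nat.descFactorial_eq_factorial_mul_choose, Nat.cast_mul]
  field_simp

theorem tendsto_mean {k : ℕ} (G H : ∀ n, (Fin k → Fin n) → Prop) {g h : ℝ}
    (hG : Tendsto (fun n => (Nat.card {y // G n y} : ℝ) / (n : ℝ) ^ k) atTop (𝓝 g))
    (hH : Tendsto (fun n => (Nat.card {y // H n y} : ℝ) / (n : ℝ) ^ k) atTop (𝓝 h)) :
    Tendsto (fun n : ℕ => (∑ ρ : Equiv.Perm (Fin n),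
      (Nat.card {y : Fin k → Fin n // G n y ∧ H n (ρ ∘ y)} : ℝ)) / n ! / (n : ℝ) ^ k)
      atTop (𝓝 (g * h)) := by
  have hD := tendsto_descFactorial_div_pow k
  have hinj : ∀ (G : ∀ n, (Fin k → Fin n) → Prop) {g : ℝ},
      Tendsto (fun n => (Nat.card {y // G n y} : ℝ) / (n : ℝ) ^ k) atTop (𝓝 g) →
      Tendsto (fun n => (Nat.card {y // Function.Injective y ∧ G n y} : ℝ) / (n : ℝ) ^ k)
        atTop (𝓝 g) := by
    intro G g hG
    -- Restricting to injective tuples loses at most the proportion of non-injective ones, which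
    -- tends to `0`.
    have hlow := (hG.add hD).sub (tendsto_const_nhds (x := (1 : ℝ)))
    rw [add_sub_cancel_right] at hlow
    refine tendsto_of_tendsto_of_tendsto_of_le_of_le' hlow hG ?_ ?_
    · filter_upwards [eventually_gt_atTop 0] with n hn
      have hpos : (0 : ℝ) < (n : ℝ) ^ k := by positivity
      have := (card_and_injective_bounds (G n)).2
      rw [← add_div, sub_le_iff_le_add, div_add_one hpos.ne', div_le_div_iff_of_pos_right hpos]
      exact_mod_cast this
    · filter_upwards with n
      have := (card_and_injective_bounds (G n)).1
      gcongr
  have hlow := ((hinj G hG).mul (hinj H hH)).div hD one_ne_zero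
  rw [div_one] at hlow
  have hup := hlow.add ((tendsto_const_nhds (x := (1 : ℝ))).sub hD)
  rw [sub_self, add_zero] at hup
  have halg : ∀ N D x y : ℝ, N ≠ 0 → x / N * (y / N) / (D / N) = x * y / D / N := by
    intro N D x y hN
    field_simp
  refine tendsto_of_tendsto_of_tendsto_of_le_of_le' hlow hup ?_ ?_
  · filter_upwards [eventually_gt_atTop 0, eventually_ge_atTop k] with n hn hkn
    have hpos : (0 : ℝ) < (n : ℝ) ^ k := by positivity
    simp only [Pi.div_apply]
    rw [halg _ _ _ _ hpos.ne', div_le_div_iff_of_pos_right hpos]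
    exact (sum_card_perm_bounds hkn (G n) (H n)).1
  · filter_upwards [eventually_gt_atTop 0, eventually_ge_atTop k] with n hn hkn
    have hpos : (0 : ℝ) < (n : ℝ) ^ k := by positivity
    simp only [Pi.div_apply]
    rw [halg _ _ _ _ hpos.ne', one_sub_div hpos.ne', ← add_div, div_le_div_iff_of_pos_right hpos]
    exact (sum_card_perm_bounds hkn (G n) (H n)).2

theorem tendsto_card_fibrewiseIncreasing {k m : ℕ} (τ : Equiv.Perm (Fin k)) (p : Fin k → Fin m) :
    Tendsto (fun n => (Nat.card {y : Fin k → Fin n // FibrewiseIncreasing τ p y} : ℝ) /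
      (n : ℝ) ^ k) atTop (𝓝 (∏ a, ((Nat.card {i // p i = a}) ! : ℝ)⁻¹)) := by
  have hk : ∑ a, Nat.card {i // p i = a} = k := by
    rw [← Nat.card_sigma, Nat.card_congr (Equiv.sigmaFiberEquiv p), Nat.card_fin]
  have h := tendsto_finsetProd (Finset.univ : Finset (Fin m)) fun a _ =>
    tendsto_choose_div_pow (Nat.card {i // p i = a})
  refine h.congr fun n => ?_
  rw [card_fibrewiseIncreasing, Finset.prod_div_distrib, Finset.prod_pow_eq_pow_sum, hk,
    Nat.cast_prod]

theorem tendsto_mean_patternCount_tensor {k m : ℕ} (τ : Equiv.Perm (Fin k))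
    (σ : Equiv.Perm (Fin m)) :
    Tendsto (fun n : ℕ => (∑ ρ : Equiv.Perm (Fin n), (patternCount τ (tensor σ ρ) : ℝ)) / n ! /
      (n : ℝ) ^ k) atTop
      (𝓝 (∑ p with IsWeakPattern τ σ p, ∏ a, (((Nat.card {i // p i = a}) ! : ℝ) ^ 2)⁻¹)) := by
  have h := tendsto_finsetSum (Finset.univ.filter (IsWeakPattern τ σ)) fun p _ =>
    tendsto_mean (fun n => FibrewiseIncreasing (n := n) 1 p)
      (fun n => FibrewiseIncreasing (n := n) τ p)
      (tendsto_card_fibrewiseIncreasing 1 p) (tendsto_card_fibrewiseIncreasing τ p)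
  simp_rw [← Finset.prod_mul_distrib, ← mul_inv, ← sq] at h
  refine h.congr fun n => ?_
  simp_rw [patternCount_tensor, Nat.cast_sum]
  rw [Finset.sum_comm, Finset.sum_div, Finset.sum_div]

/-! ### From convergence in probability to convergence of means -/

theorem uniformPerm_apply (n : ℕ) (s : Set (Equiv.Perm (Fin n))) :
    uniformPerm n s = ENNReal.ofReal ((Nat.card s : ℝ) / n !) := by
  have : MeasurableSingletonClass (Equiv.Perm (Fin n)) := ⟨fun _ => trivial⟩
  rw [uniformPerm, ProbabilityTheory.uniformOn_univ, Measure.count_apply (show MeasurableSet s from trivial),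
    ENNReal.ofReal_div_of_pos (by positivity), Fintype.card_perm, Fintype.card_fin,
    ENNReal.ofReal_natCast, ENNReal.ofReal_natCast,
    Nat.card_coe_set_eq, ← s.toFinite.cast_ncard_eq, ENat.toENNReal_coe]

/-- Values below `ε` contribute at most `ε` to the mean; the others contribute at most `C` times
their probability. -/
theorem tendsto_mean_zero_of_bounded {f : ∀ n, Equiv.Perm (Fin n) → ℝ} {C : ℝ}
    (hC : ∀ n ρ, |f n ρ| ≤ C)
    (h : ∀ ε : ℝ, 0 < ε → Tendsto (fun n => uniformPerm n {ρ | ε ≤ |f n ρ|}) atTop (𝓝 0)) :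
    Tendsto (fun n => (∑ ρ, f n ρ) / n !) atTop (𝓝 0) := by
  have hC0 : 0 ≤ C := (abs_nonneg _).trans (hC 0 1)
  have hbound : ∀ ε : ℝ, 0 < ε → ∀ n,
      |(∑ ρ, f n ρ) / n !| ≤ ε + C * (uniformPerm n {ρ | ε ≤ |f n ρ|}).toReal := by
    intro ε hε n
    have hn : (0 : ℝ) < n ! := by positivity
    rw [uniformPerm_apply, ENNReal.toReal_ofReal (by positivity), abs_div, abs_of_pos hn,
      div_le_iff₀ hn, add_mul, mul_assoc, div_mul_cancel₀ _ hn.ne']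
    calc |∑ ρ, f n ρ| ≤ ∑ ρ, |f n ρ| := Finset.abs_sum_le_sum_abs _ _
      _ ≤ ∑ ρ, (ε + if ε ≤ |f n ρ| then C else 0) := by
        refine Finset.sum_le_sum fun ρ _ => ?_
        split_ifs with hρ
        · linarith [hC n ρ]
        · linarith
      _ = _ := by
        rw [Finset.sum_add_distrib, ← Finset.sum_filter, Finset.sum_const, Finset.sum_const,
          Finset.card_univ, Fintype.card_perm, Fintype.card_fin, nsmul_eq_mul, nsmul_eq_mul,
          Set.coe_ofPred, Nat.card_eq_fintype_card, Fintype.card_subtype]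
        ring
  rw [Metric.tendsto_atTop]
  intro ε hε
  have h1 := (ENNReal.tendsto_toReal ENNReal.zero_ne_top).comp (h (ε / 2) (half_pos hε))
  have h2 := h1.const_mul C
  rw [ENNReal.toReal_zero, mul_zero] at h2
  obtain ⟨N, hN⟩ := eventually_atTop.1 (h2.eventually_lt_const (half_pos hε))
  refine ⟨N, fun n hn => ?_⟩
  rw [Real.dist_0_eq_abs]
  have h3 := hN n hn
  have h4 := hbound (ε / 2) (half_pos hε) n
  simp only [Function.comp_apply] at h3
  linarith

theorem Inflatable.pos {k m : ℕ} {σ : Equiv.Perm (Fin m)} (hσ : Inflatable k σ) : 0 < m := by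
  rcases Nat.eq_zero_or_pos m with rfl | h
  · have h1 : Tendsto (fun n : ℕ => 0 * n) atTop atTop := hσ.1
    simp only [zero_mul] at h1
    exact absurd h1 (not_tendsto_const_atTop _ _)
  · exact h

theorem Inflatable.tendsto_mean {k m : ℕ} {σ : Equiv.Perm (Fin m)} (hσ : Inflatable k σ)
    (τ : Equiv.Perm (Fin k)) :
    Tendsto (fun n : ℕ => (∑ ρ : Equiv.Perm (Fin n), (patternCount τ (tensor σ ρ) : ℝ)) / n ! /
      (n : ℝ) ^ k) atTop (𝓝 ((m : ℝ) ^ k / (k ! : ℝ) ^ 2)) := by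
  have hm : (0 : ℝ) < m := by exact_mod_cast hσ.pos
  -- The ratio lies in `[0, k!²]` because a pattern count is at most `(m * n) ^ k`; subtracting `1`
  -- leaves it within `k!² + 1` of zero.
  have h := tendsto_mean_zero_of_bounded (C := (k ! : ℝ) ^ 2 + 1) (f := fun n ρ =>
    ((k ! : ℝ) ^ 2 * (patternCount τ (tensor σ ρ) : ℝ)) / ((m * n : ℕ) : ℝ) ^ k - 1)
    (fun n ρ => by
      have h0 : (0 : ℝ) ≤ ((k ! : ℝ) ^ 2 * (patternCount τ (tensor σ ρ) : ℝ)) /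
        ((m * n : ℕ) : ℝ) ^ k := by positivity
      have h1 : ((k ! : ℝ) ^ 2 * (patternCount τ (tensor σ ρ) : ℝ)) /
          ((m * n : ℕ) : ℝ) ^ k ≤ (k ! : ℝ) ^ 2 := by
        refine div_le_of_le_mul₀ (by positivity) (by positivity) ?_
        gcongr
        exact_mod_cast patternCount_le τ (tensor σ ρ)
      rw [abs_le]
      constructor <;> linarith [sq_nonneg (k ! : ℝ)])
    (hσ.2 τ)
  have h' := (h.add_const 1).const_mul ((m : ℝ) ^ k / (k ! : ℝ) ^ 2)
  rw [zero_add, mul_one] at h'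
  refine h'.congr' ?_
  filter_upwards [eventually_gt_atTop 0] with n hn
  have hn : (0 : ℝ) < n := by exact_mod_cast hn
  have hf : (0 : ℝ) < n ! := by positivity
  rw [Finset.sum_sub_distrib, ← Finset.sum_div, ← Finset.mul_sum, Finset.sum_const,
    Finset.card_univ, Fintype.card_perm, Fintype.card_fin, nsmul_eq_mul, mul_one, sub_div,
    div_self hf.ne', sub_add_cancel, Nat.cast_mul, mul_pow]
  field_simp

/-! ### Weak patterns and consistent partitions -/

instance {k m : ℕ} (p : Fin k → Fin m) : DecidableRel (Setoid.ker p) :=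
  fun i j => inferInstanceAs (Decidable (p i = p j))

/-- The partition of `Fin k` into the nonempty fibres of `p`. -/
def fibrePartition {k m : ℕ} (p : Fin k → Fin m) :
    Finpartition (Finset.univ : Finset (Fin k)) :=
  Finpartition.ofSetoid (Setoid.ker p)

theorem mem_part_fibrePartition {k m : ℕ} (p : Fin k → Fin m) (i j : Fin k) :
    j ∈ (fibrePartition p).part i ↔ p i = p j := by
  rw [fibrePartition, Finpartition.mem_part_ofSetoid_iff_rel]
  rfl

theorem part_fibrePartition {k m : ℕ} (p : Fin k → Fin m) (i : Fin k) :
    (fibrePartition p).part i = Finset.univ.filter fun j => p j = p i := by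
  ext j
  rw [mem_part_fibrePartition, Finset.mem_filter, eq_comm]
  simp

theorem finpartition_ext_part {k : ℕ} {π π' : Finpartition (Finset.univ : Finset (Fin k))}
    (h : ∀ i j, j ∈ π.part i ↔ j ∈ π'.part i) : π = π' := by
  have key : ∀ π π' : Finpartition (Finset.univ : Finset (Fin k)),
      (∀ i, π.part i = π'.part i) → π.parts ⊆ π'.parts := by
    intro π π' h J hJ
    obtain ⟨i, hi⟩ := π.nonempty_of_mem_parts hJ
    rw [← π.part_eq_of_mem hJ hi, h]
    exact π'.part_mem.2 (Finset.mem_univ i)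
  have h' : ∀ i, π.part i = π'.part i := fun i => Finset.ext (h i)
  exact Finpartition.ext (Finset.Subset.antisymm (key _ _ h') (key _ _ fun i => (h' i).symm))

theorem fibrePartition_eq_iff {k m : ℕ} (p : Fin k → Fin m)
    (π : Finpartition (Finset.univ : Finset (Fin k))) :
    fibrePartition p = π ↔ ∀ i j, j ∈ π.part i ↔ p i = p j := by
  constructor
  · rintro rfl
    exact mem_part_fibrePartition p
  · exact fun h => finpartition_ext_part fun i j => by rw [mem_part_fibrePartition, h]

theorem isInterval_of_ordConnected {k : ℕ} {J : Finset (Fin k)} (hJ : J.Nonempty)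
    (h : ∀ i ∈ J, ∀ j ∈ J, ∀ x, i ≤ x → x ≤ j → x ∈ J) : IsInterval J := by
  refine ⟨J.min' hJ, J.max' hJ, ?_⟩
  ext x
  rw [Finset.mem_Icc]
  exact ⟨fun hx => ⟨J.min'_le x hx, J.le_max' x hx⟩,
    fun hx => h _ (J.min'_mem hJ) _ (J.max'_mem hJ) x hx.1 hx.2⟩

theorem IsInterval.lt_of_lt {k : ℕ} {A B : Finset (Fin k)} (hA : IsInterval A)
    (hB : IsInterval B) (hAB : Disjoint A B) {a b a' b' : Fin k} (ha : a ∈ A) (hb : b ∈ B)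
    (ha' : a' ∈ A) (hb' : b' ∈ B) (h : a < b) : a' < b' := by
  obtain ⟨a₁, a₂, rfl⟩ := hA
  obtain ⟨b₁, b₂, rfl⟩ := hB
  rw [Finset.disjoint_left] at hAB
  have h1 := @hAB a
  have h2 := @hAB b
  have h3 := @hAB a'
  have h4 := @hAB b'
  simp only [Finset.mem_Icc] at *
  by_contra hlt
  rw [not_lt] at hlt
  rcases lt_or_ge b a' with hba | hba
  · exact h2 ⟨ha.1.trans h.le, hba.le.trans ha'.2⟩ hb
  · exact h3 ha' ⟨hb'.1.trans hlt, hba.trans hb.2⟩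

/-- The parts of `π` are intervals, and so are their images under `τ`. -/
def IsConsistent {k : ℕ} (τ : Equiv.Perm (Fin k))
    (π : Finpartition (Finset.univ : Finset (Fin k))) : Prop :=
  ∀ J ∈ π.parts, IsInterval J ∧ IsInterval (J.map τ.toEmbedding)

instance {k : ℕ} (τ : Equiv.Perm (Fin k)) (π : Finpartition (Finset.univ : Finset (Fin k))) :
    Decidable (IsConsistent τ π) :=
  inferInstanceAs (Decidable (∀ J ∈ π.parts, IsInterval J ∧ IsInterval (J.map τ.toEmbedding)))

theorem IsConsistent.lt_of_lt {k : ℕ} {τ : Equiv.Perm (Fin k)}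
    {π : Finpartition (Finset.univ : Finset (Fin k))} (hπ : IsConsistent τ π) {i j i' j' : Fin k}
    (hi : i' ∈ π.part i) (hj : j' ∈ π.part j) (hij : π.part i ≠ π.part j) (h : i < j) :
    i' < j' :=
  (hπ _ (π.part_mem.2 (Finset.mem_univ i))).1.lt_of_lt
    (hπ _ (π.part_mem.2 (Finset.mem_univ j))).1
    (π.disjoint (π.part_mem.2 (Finset.mem_univ i)) (π.part_mem.2 (Finset.mem_univ j)) hij)
    (π.mem_part (Finset.mem_univ i)) (π.mem_part (Finset.mem_univ j)) hi hj h

theorem IsConsistent.map_lt_of_lt {k : ℕ} {τ : Equiv.Perm (Fin k)}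
    {π : Finpartition (Finset.univ : Finset (Fin k))} (hπ : IsConsistent τ π) {i j i' j' : Fin k}
    (hi : i' ∈ π.part i) (hj : j' ∈ π.part j) (hij : π.part i ≠ π.part j) (h : τ i < τ j) :
    τ i' < τ j' :=
  (hπ _ (π.part_mem.2 (Finset.mem_univ i))).2.lt_of_lt
    (hπ _ (π.part_mem.2 (Finset.mem_univ j))).2
    ((Finset.disjoint_map _).2 (π.disjoint (π.part_mem.2 (Finset.mem_univ i))
      (π.part_mem.2 (Finset.mem_univ j)) hij))
    (Finset.mem_map_of_mem _ (π.mem_part (Finset.mem_univ i)))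
    (Finset.mem_map_of_mem _ (π.mem_part (Finset.mem_univ j)))
    (Finset.mem_map_of_mem _ hi) (Finset.mem_map_of_mem _ hj) h

/-- Fibres of a monotone map are convex. This applies to `p`, and to `σ ∘ p ∘ τ⁻¹`, whose fibres are
the `τ`-images of those of `p` because `σ` is injective. -/
theorem IsWeakPattern.isConsistent {k m : ℕ} {τ : Equiv.Perm (Fin k)} {σ : Equiv.Perm (Fin m)}
    {p : Fin k → Fin m} (hp : IsWeakPattern τ σ p) : IsConsistent τ (fibrePartition p) := by
  intro J hJ
  have hne := (fibrePartition p).nonempty_of_mem_parts hJ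
  obtain ⟨r, hr⟩ := hne
  rw [← (fibrePartition p).part_eq_of_mem hJ hr, part_fibrePartition]
  constructor
  · refine isInterval_of_ordConnected ⟨r, by simp⟩ fun i hi j hj x hix hxj => ?_
    simp only [Finset.mem_filter, Finset.mem_univ, true_and] at hi hj ⊢
    exact le_antisymm (hj ▸ hp.1 hxj) (hi ▸ hp.1 hix)
  · refine isInterval_of_ordConnected ⟨τ r, by simp⟩ fun i hi j hj x hix hxj => ?_
    simp only [Finset.mem_map_equiv, Finset.mem_filter, Finset.mem_univ, true_and] at hi hj ⊢
    have h1 := hp.2 (τ.symm i) (τ.symm x) (by simpa using hix)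
    have h2 := hp.2 (τ.symm x) (τ.symm j) (by simpa using hxj)
    rw [hi] at h1
    rw [hj] at h2
    exact σ.injective (le_antisymm h2 h1)

/-! ### Representatives -/

/-- The `a`-th representative. -/
def rep {k : ℕ} (π : Finpartition (Finset.univ : Finset (Fin k))) :
    Fin π.parts.card ↪o Fin k :=
  (representatives π).orderEmbOfFin (card_representatives π)

theorem exists_rep {k : ℕ} (π : Finpartition (Finset.univ : Finset (Fin k))) (i : Fin k) :
    ∃ a, rep π a ∈ π.part i := by
  have hJ := π.part_mem.2 (Finset.mem_univ i)
  have hmin := (π.part i).min'_mem (π.nonempty_of_mem_parts hJ)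
  have hmem : (π.part i).min' (π.nonempty_of_mem_parts hJ) ∈ representatives π :=
    Finset.mem_image.2 ⟨⟨π.part i, hJ⟩, Finset.mem_attach _ _, rfl⟩
  have hrange : (π.part i).min' (π.nonempty_of_mem_parts hJ) ∈ Set.range (rep π) := by
    rw [rep, Finset.range_orderEmbOfFin]
    exact hmem
  obtain ⟨a, ha⟩ := hrange
  exact ⟨a, ha ▸ hmin⟩

theorem part_rep_injective {k : ℕ} (π : Finpartition (Finset.univ : Finset (Fin k))) :
    Function.Injective fun a => π.part (rep π a) := by
  have hmin : ∀ a, ∃ J, ∃ hJ : J ∈ π.parts, rep π a = J.min' (π.nonempty_of_mem_parts hJ) := by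
    intro a
    have : rep π a ∈ representatives π := Finset.orderEmbOfFin_mem _ _ a
    obtain ⟨J, -, hJ⟩ := Finset.mem_image.1 this
    exact ⟨J.1, J.2, hJ.symm⟩
  intro a b h
  obtain ⟨A, hA, ha⟩ := hmin a
  obtain ⟨B, hB, hb⟩ := hmin b
  have hA' : π.part (rep π a) = A := π.part_eq_of_mem hA (ha ▸ A.min'_mem _)
  have hB' : π.part (rep π b) = B := π.part_eq_of_mem hB (hb ▸ B.min'_mem _)
  have hAB : A = B := hA'.symm.trans (h.trans hB')
  subst hAB
  exact (rep π).injective (ha.trans hb.symm)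

/-- The index of the part that contains `i`. -/
noncomputable def partIndex {k : ℕ} (π : Finpartition (Finset.univ : Finset (Fin k)))
    (i : Fin k) : Fin π.parts.card :=
  (exists_rep π i).choose

theorem rep_partIndex_mem {k : ℕ} (π : Finpartition (Finset.univ : Finset (Fin k))) (i : Fin k) :
    rep π (partIndex π i) ∈ π.part i :=
  (exists_rep π i).choose_spec

theorem part_rep_partIndex {k : ℕ} (π : Finpartition (Finset.univ : Finset (Fin k))) (i : Fin k) :
    π.part (rep π (partIndex π i)) = π.part i :=
  π.part_eq_of_mem (π.part_mem.2 (Finset.mem_univ i)) (rep_partIndex_mem π i)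

theorem mem_part_iff_part_eq {k : ℕ} (π : Finpartition (Finset.univ : Finset (Fin k)))
    (i j : Fin k) : j ∈ π.part i ↔ π.part i = π.part j :=
  ⟨fun h => (π.part_eq_of_mem (π.part_mem.2 (Finset.mem_univ i)) h).symm,
    fun h => h ▸ π.mem_part (Finset.mem_univ j)⟩

theorem partIndex_eq_iff {k : ℕ} (π : Finpartition (Finset.univ : Finset (Fin k)))
    (i j : Fin k) : partIndex π i = partIndex π j ↔ π.part i = π.part j := by
  rw [← (part_rep_injective π).eq_iff, part_rep_partIndex, part_rep_partIndex]

theorem partIndex_rep {k : ℕ} (π : Finpartition (Finset.univ : Finset (Fin k)))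
    (a : Fin π.parts.card) : partIndex π (rep π a) = a :=
  part_rep_injective π (part_rep_partIndex π (rep π a))

theorem contract_lt_contract_iff {k : ℕ} (τ : Equiv.Perm (Fin k))
    (π : Finpartition (Finset.univ : Finset (Fin k))) (a b : Fin π.parts.card) :
    contract τ π a < contract τ π b ↔ τ (rep π a) < τ (rep π b) :=
  contract_lt_iff τ π a b

/-- Disjoint intervals compare as blocks, so an inequality between elements of different parts, in
position or in `τ`-value, passes to the representatives. -/
theorem IsConsistent.isWeakPattern_comp {k m : ℕ} {τ : Equiv.Perm (Fin k)}
    {σ : Equiv.Perm (Fin m)} {π : Finpartition (Finset.univ : Finset (Fin k))}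
    (hπ : IsConsistent τ π) {g : Fin π.parts.card → Fin m}
    (hg : IsEmbeddedPattern (contract τ π) σ g) : IsWeakPattern τ σ (g ∘ partIndex π) := by
  constructor
  · intro i j hij
    by_cases h : π.part i = π.part j
    · exact (congrArg g ((partIndex_eq_iff π i j).2 h)).le
    · have hlt : i < j := lt_of_le_of_ne hij fun h' => h (congrArg π.part h')
      exact (hg.1 ((rep π).lt_iff_lt.1
        (hπ.lt_of_lt (rep_partIndex_mem π i) (rep_partIndex_mem π j) h hlt))).le
  · intro i j hij
    by_cases h : π.part i = π.part j
    · exact (congrArg (σ ∘ g) ((partIndex_eq_iff π i j).2 h)).le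
    · have hlt : τ i < τ j :=
        lt_of_le_of_ne hij fun h' => h (congrArg π.part (τ.injective h'))
      exact (hg.2 _ _ ((contract_lt_contract_iff τ π _ _).2
        (hπ.map_lt_of_lt (rep_partIndex_mem π i) (rep_partIndex_mem π j) h hlt))).le

/-- Representatives lie in distinct fibres, so the weak inequalities become strict. -/
theorem IsWeakPattern.isEmbeddedPattern_comp_rep {k m : ℕ} {τ : Equiv.Perm (Fin k)}
    {σ : Equiv.Perm (Fin m)} {π : Finpartition (Finset.univ : Finset (Fin k))} {p : Fin k → Fin m}
    (hp : IsWeakPattern τ σ p) (hπ : fibrePartition p = π) :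
    IsEmbeddedPattern (contract τ π) σ (p ∘ rep π) := by
  rw [fibrePartition_eq_iff] at hπ
  have hinj : Function.Injective (p ∘ rep π) := fun a b h =>
    part_rep_injective π ((mem_part_iff_part_eq π _ _).1 ((hπ _ _).2 h))
  refine ⟨(hp.1.comp (rep π).monotone).strictMono_of_injective hinj, fun a b hab => ?_⟩
  refine lt_of_le_of_ne (hp.2 _ _ ((contract_lt_contract_iff τ π a b).1 hab).le) fun h => ?_
  rw [hinj (σ.injective h)] at hab
  exact lt_irrefl _ hab

/-- The weak patterns with a given consistent partition into fibres correspond to the occurrences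
of the contracted permutation. -/
theorem card_isWeakPattern_fibrePartition_eq {k m : ℕ} {τ : Equiv.Perm (Fin k)}
    (σ : Equiv.Perm (Fin m)) {π : Finpartition (Finset.univ : Finset (Fin k))}
    (hπ : IsConsistent τ π) :
    Nat.card {p : Fin k → Fin m // IsWeakPattern τ σ p ∧ fibrePartition p = π} =
      patternCount (contract τ π) σ := by
  rw [patternCount_eq_card]
  refine Nat.card_congr
    { toFun := fun p => ⟨p.1 ∘ rep π, p.2.1.isEmbeddedPattern_comp_rep p.2.2⟩
      invFun := fun g => ⟨g.1 ∘ partIndex π, hπ.isWeakPattern_comp g.2,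
        (fibrePartition_eq_iff _ _).2 fun i j => by
          rw [mem_part_iff_part_eq, ← partIndex_eq_iff, Function.comp_apply, Function.comp_apply,
            g.2.1.injective.eq_iff]⟩
      left_inv := fun p => Subtype.ext (funext fun i =>
        (((fibrePartition_eq_iff _ _).1 p.2.2 _ _).1 (rep_partIndex_mem π i)).symm)
      right_inv := fun g => Subtype.ext (funext fun a => congrArg g.1 (partIndex_rep π a)) }

/-- The left product also runs over values that `p` misses; `f 0 = 1` makes them harmless. -/
theorem prod_fibrePartition {k m : ℕ} (p : Fin k → Fin m) (f : ℕ → ℝ) (hf : f 0 = 1) :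
    ∏ a, f (Nat.card {i // p i = a}) = ∏ J ∈ (fibrePartition p).parts, f J.card := by
  have hcard : ∀ a, Nat.card {i // p i = a} = (Finset.univ.filter fun i => p i = a).card :=
    fun a => by rw [Nat.card_eq_fintype_card, Fintype.card_subtype]
  have hparts : (fibrePartition p).parts =
      (Finset.univ.image p).image fun a => Finset.univ.filter fun i => p i = a := by
    ext J
    simp only [Finset.mem_image, Finset.mem_univ, true_and, exists_exists_eq_and]
    constructor
    · intro hJ
      obtain ⟨r, hr⟩ := (fibrePartition p).nonempty_of_mem_parts hJ
      exact ⟨r, by rw [← part_fibrePartition, (fibrePartition p).part_eq_of_mem hJ hr]⟩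
    · rintro ⟨r, rfl⟩
      rw [← part_fibrePartition]
      exact (fibrePartition p).part_mem.2 (Finset.mem_univ r)
  simp_rw [hcard]
  rw [hparts, Finset.prod_image]
  · symm
    refine Finset.prod_subset (Finset.subset_univ _) fun a _ ha => ?_
    have : (Finset.univ.filter fun i => p i = a) = ∅ :=
      Finset.filter_eq_empty_iff.2 fun i _ h => ha (Finset.mem_image.2 ⟨i, Finset.mem_univ i, h⟩)
    rw [this, Finset.card_empty, hf]
  · intro a ha b _ hab
    obtain ⟨i, -, rfl⟩ := Finset.mem_image.1 ha
    exact (Finset.mem_filter.1 ((Finset.ext_iff.1 hab i).1 (by simp))).2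

theorem sum_isWeakPattern {k m : ℕ} (hk : 1 ≤ k) (τ : Equiv.Perm (Fin k))
    (σ : Equiv.Perm (Fin m)) (f : ℕ → ℝ) (hf : f 0 = 1) :
    ∑ p with IsWeakPattern τ σ p, ∏ a, f (Nat.card {i // p i = a}) =
      ∑ t ∈ Finset.Icc 1 k, ∑ π ∈ consistentPartitions τ t,
        (patternCount (contract τ π) σ : ℝ) * ∏ J ∈ π.parts, f J.card := by
  have hfib : ∀ t, consistentPartitions τ t =
      (Finset.univ.filter (IsConsistent τ)).filter fun π => π.parts.card = t := by
    intro t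
    ext π
    simp [consistentPartitions, IsConsistent, and_comm]
  simp_rw [hfib]
  rw [Finset.sum_fiberwise_of_maps_to (t := Finset.Icc 1 k)
    (g := fun π : Finpartition (Finset.univ : Finset (Fin k)) => π.parts.card)]
  · rw [← Finset.sum_fiberwise_of_maps_to (t := Finset.univ.filter (IsConsistent τ))
      (g := fibrePartition)]
    · refine Finset.sum_congr rfl fun π hπ => ?_
      rw [← card_isWeakPattern_fibrePartition_eq σ (Finset.mem_filter.1 hπ).2,
        Nat.card_eq_fintype_card, Fintype.card_subtype, Finset.filter_filter, ← nsmul_eq_mul]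
      refine Finset.sum_eq_card_nsmul fun p hp => ?_
      rw [prod_fibrePartition p f hf, (Finset.mem_filter.1 hp).2.2]
    · intro p hp
      simpa using (Finset.mem_filter.1 hp).2.isConsistent
  · intro π _
    rw [Finset.mem_Icc]
    refine ⟨?_, by simpa using π.card_parts_le_card⟩
    -- The hypothesis `1 ≤ k` supplies an element, hence at least one part, so the sum may start at
    -- `t = 1`.
    have : (⟨0, hk⟩ : Fin k) ∈ Finset.univ := Finset.mem_univ _
    exact Finset.card_pos.2 ⟨_, π.part_mem.2 this⟩

end PermPattern

theorem mainTheorem4 (k m : ℕ) (hk : 1 ≤ k) (σ : Equiv.Perm (Fin m))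
    (hσ : PermPattern.Inflatable k σ) (τ : Equiv.Perm (Fin k)) :
    (m : ℝ) ^ k / (k ! : ℝ) ^ 2 =
      ∑ t ∈ Finset.Icc 1 k, ∑ π ∈ PermPattern.consistentPartitions τ t,
        (PermPattern.patternCount (PermPattern.contract τ π) σ : ℝ) *
          ∏ J ∈ π.parts, ((J.card ! : ℝ) ^ 2)⁻¹ := by
  rw [← PermPattern.sum_isWeakPattern hk τ σ (fun c => ((c ! : ℝ) ^ 2)⁻¹) (by simp)]
  exact tendsto_nhds_unique (hσ.tendsto_mean τ) (PermPattern.tendsto_mean_patternCount_tensor τ σ)
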